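/- **Theorem.** Let $q$ be a prime power and let $K=\mathbb F_q((t^{-1}))$ be the field of formal Laurent series $f=a_nt^n+\dots+a_1t+a_0+a_{-1}t^{-1}+\cdots$ ($a_i\in\mathbb F_q$), with its usual topology. For such $f$ with $a_n\neq 0$ put $\deg f=n$; put $\deg 0=-\infty$, $|f|=q^{\deg f}$, and write $[f]=a_nt^n+\dots+a_1t+a_0$ for the polynomial part of $f$. Let $\mathcal O=\{f\in K:|f|\le 1\}$ and $\mathbb L=\{f\in K:|f|<1\}$, and let $\mu$ be the Haar measure of $(K,+)$ normalized by $\mu(\mathcal O)=1$. The geometric Farey map $F:\mathbb L\times\mathbb Z\to\mathbb L\times\mathbb Z$ is $$F(f,n)=\begin{cases}\left(tf-[tf],\;n+1\right)&\text{if }\deg f<-1\text{ or }n<0,\\[4pt] \left(\dfrac1{tf}-\left[\dfrac1{tf}\right],\;-(n+1)\right)&\text{if }\deg f=-1\text{ and }n\ge 0.\end{cases}$$ Let $\mu_G$ be the measure on $\mathbb L\times\mathbb Z$ such that, for every measurable $\mathbf E\subset\mathbb L$, $$\mu_G(\mathbf E\times\{n\})=\begin{cases}\dfrac{q-1}{2q^{n}}\,\mu(\mathbf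 E)&\text{if }n\ge 0,\\[6pt] \dfrac{q-1}{2q^{-n-1}}\,\mu(\mathbf E)&\text{if }n<0.\end{cases}$$ Then $\mu_G$ is an ergodic invariant measure for $F$. -/

import Mathlib

open MeasureTheory
open scoped LaurentSeries WithZero Topology ENNReal

noncomputable section

namespace GeometricFarey

/- Throughout, `F` is a finite field with `q` elements and `K = 𝔽_q((t⁻¹))` is realized as Mathlib's
field `F⸨X⸩` of formal Laurent series in the variable `X = t⁻¹`, with its valued (`X`-adic)
topology. So `f.coeff i` is the coefficient of `t ^ (-i)` in `f`. -/

/-- The Borel `σ`-algebra of `𝔽_q((t⁻¹))`. -/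
instance instMeasurableSpaceLaurent (F : Type*) [Field F] : MeasurableSpace F⸨X⸩ := borel F⸨X⸩

instance instBorelSpaceLaurent (F : Type*) [Field F] : BorelSpace F⸨X⸩ := ⟨rfl⟩

/-- The element `t = X⁻¹` of `𝔽_q((t⁻¹))`. -/
def t (F : Type*) [Field F] : F⸨X⸩ := HahnSeries.single (-1 : ℤ) (1 : F)

open Classical in
/-- The degree in `t`: `deg f = n` if `f = ∑_{i ≤ n} a_i t ^ i` with `a_n ≠ 0`,
and `deg 0 = -∞`. -/
def deg {F : Type*} [Field F] (f : F⸨X⸩) : WithBot ℤ :=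
  if f = 0 then ⊥ else ((-f.order : ℤ) : WithBot ℤ)

/-- `𝕃 = {f : |f| < 1} = {f : deg f < 0}`. -/
def L (F : Type*) [Field F] : Set F⸨X⸩ := {f | deg f < 0}

/-- The valuation ring `𝒪 = {f : |f| ≤ 1} = {f : deg f ≤ 0}`. -/
def O (F : Type*) [Field F] : Set F⸨X⸩ := {f | deg f ≤ 0}

/-- The polynomial part
`[a_n t ^ n + ⋯ + a_1 t + a_0 + a_{-1} t ^ (-1) + ⋯] = a_n t ^ n + ⋯ + a_1 t + a_0`:
only the coefficients of `X ^ i = t ^ (-i)` with `i < 1` are kept. -/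
def polyPart {F : Type*} [Field F] (f : F⸨X⸩) : F⸨X⸩ := HahnSeries.truncLT (1 : ℤ) f

theorem deg_le_iff {F : Type*} [Field F] (f : F⸨X⸩) (m : ℤ) :
    deg f ≤ (m : WithBot ℤ) ↔ ∀ i : ℤ, i < -m → f.coeff i = 0 := by
  unfold deg
  split_ifs with h
  · simp [h]
  · rw [WithBot.coe_le_coe]
    constructor
    · intro hm i hi
      exact HahnSeries.coeff_eq_zero_of_lt_order (by omega)
    · intro hc
      by_contra hm
      exact HahnSeries.coeff_order_eq_zero.not.mpr h (hc _ (by omega))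

theorem mem_L_iff {F : Type*} [Field F] (f : F⸨X⸩) :
    f ∈ L F ↔ ∀ i : ℤ, i < 1 → f.coeff i = 0 := by
  have h := deg_le_iff f (-1)
  rw [neg_neg] at h
  rw [← h]
  change deg f < 0 ↔ _
  unfold deg
  split_ifs
  · simp
  · rw [← WithBot.coe_zero, WithBot.coe_lt_coe, WithBot.coe_le_coe]
    omega

theorem sub_polyPart_mem_L {F : Type*} [Field F] (f : F⸨X⸩) : f - polyPart f ∈ L F := by
  rw [mem_L_iff]
  intro i hi
  simp [polyPart, HahnSeries.truncLT, hi]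

/-- `{f} = f - [f]`, an element of `𝕃`. -/
def frac {F : Type*} [Field F] (f : F⸨X⸩) : L F := ⟨f - polyPart f, sub_polyPart_mem_L f⟩

open Classical in
/-- The geometric Farey map on `𝕃 × ℤ`. As `deg f ≤ -1` on `𝕃`, the last case is
`deg f = -1` and `n ≥ 0`. -/
def fareyMap (F : Type*) [Field F] : L F × ℤ → L F × ℤ := fun x =>
  if deg (x.1 : F⸨X⸩) < ((-1 : ℤ) : WithBot ℤ) ∨ x.2 < 0 then
    (frac (t F * x.1), x.2 + 1)
  else
    (frac (1 / (t F * x.1)), -(x.2 + 1))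

theorem mem_O_iff {F : Type*} [Field F] (f : F⸨X⸩) : f ∈ O F ↔ Valued.v f ≤ (1 : ℤᵐ⁰) := by
  have h1 := deg_le_iff f 0
  have h2 := LaurentSeries.valuation_le_iff_coeff_lt_eq_zero F (D := 0) (f := f)
  simp only [neg_zero, WithBot.coe_zero, WithZero.exp_zero] at h1 h2
  exact h1.trans h2.symm

theorem isOpen_O (F : Type*) [Field F] : IsOpen (O F) := by
  have : O F = {f : F⸨X⸩ | Valued.v f ≤ (1 : ℤᵐ⁰)} := Set.ext mem_O_iff
  rw [this]
  exact Valued.isOpen_integer F⸨X⸩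

theorem isCompact_O (F : Type*) [Field F] [Finite F] : IsCompact (O F) := by
  let _ : TopologicalSpace F := ⊥
  have : DiscreteTopology F := ⟨rfl⟩
  let φ : (ℕ → F) → F⸨X⸩ := fun a => HahnSeries.ofPowerSeries ℤ F (PowerSeries.mk a)
  have hφ : Continuous φ := by
    rw [continuous_iff_continuousAt]
    intro a
    rw [ContinuousAt, Filter.tendsto_def]
    intro s hs
    obtain ⟨γ, hγ⟩ := Valued.mem_nhds.mp hs
    set D : ℤ := -(WithZero.log (MonoidWithZeroHom.ValueGroup₀.embedding γ.1) - 1) with hD₀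
    have hD : WithZero.exp (-D) < MonoidWithZeroHom.ValueGroup₀.embedding γ.1 := by
      rw [← WithZero.lt_log_iff_exp_lt (by simp), hD₀]
      simp
    have hev : ∀ᶠ b in 𝓝 a, ∀ i ∈ Finset.range D.toNat, b i = a i := by
      rw [Filter.eventually_all_finset]
      intro i _
      exact ((continuous_apply i).tendsto a).eventually
        (show ∀ᶠ y in 𝓝 (a i), y = a i by simp [nhds_discrete])
    filter_upwards [hev] with b hb
    suffices h : φ b ∈ {y : F⸨X⸩ |
        Valued.v (y - φ a) < MonoidWithZeroHom.ValueGroup₀.embedding γ.1} by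
      simp_rw [← Valued.v.restrict_lt_iff_lt_embedding] at h
      exact hγ h
    refine lt_of_le_of_lt ?_ hD
    rw [LaurentSeries.valuation_le_iff_coeff_lt_eq_zero]
    intro n hn
    rw [HahnSeries.coeff_sub, sub_eq_zero]
    simp only [φ, PowerSeries.coeff_coe]
    split_ifs with h0
    · rfl
    · rw [PowerSeries.coeff_mk, PowerSeries.coeff_mk]
      exact hb _ (Finset.mem_range.mpr (by omega))
  have hr : Set.range φ = O F := by
    ext f
    rw [mem_O_iff, LaurentSeries.val_le_one_iff_eq_coe]
    constructor
    · rintro ⟨a, rfl⟩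
      exact ⟨_, rfl⟩
    · rintro ⟨p, rfl⟩
      refine ⟨fun n => PowerSeries.coeff n p, ?_⟩
      simp only [φ]
      congr 1
      ext n
      simp
  rw [← hr]
  exact isCompact_range hφ

/-- `𝒪` as a compact set with non-empty interior. -/
def compactO (F : Type*) [Field F] [Finite F] : TopologicalSpace.PositiveCompacts F⸨X⸩ where
  carrier := O F
  isCompact' := isCompact_O F
  interior_nonempty' := by
    rw [(isOpen_O F).interior_eq]
    exact ⟨0, by simp [O, deg]⟩

/-- The Haar measure `μ` of `𝔽_q((t⁻¹))`, normalized by `μ(𝒪) = 1`. -/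
def haar (F : Type*) [Field F] [Finite F] : Measure F⸨X⸩ := Measure.addHaarMeasure (compactO F)

/-- The weight of `𝕃 × {n}`: `(q - 1) / (2 q ^ n)` for `n ≥ 0` and
`(q - 1) / (2 q ^ (-n - 1))` for `n < 0`. -/
def weight (q : ℕ) (n : ℤ) : ℝ :=
  if 0 ≤ n then ((q : ℝ) - 1) / (2 * (q : ℝ) ^ n) else ((q : ℝ) - 1) / (2 * (q : ℝ) ^ (-n - 1))

/-- The measure `μ_G` on `𝕃 × ℤ`: the sum over `n` of the copies on `𝕃 × {n}` of the restriction
of `μ` to `𝕃`, multiplied by the weights. -/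
def muG (F : Type*) [Field F] [Fintype F] : Measure (L F × ℤ) :=
  Measure.sum fun n : ℤ => ENNReal.ofReal (weight (Fintype.card F) n) •
    ((haar F).comap (Subtype.val : L F → F⸨X⸩)).map (fun f => (f, n))

theorem measurableSet_L (F : Type*) [Field F] : MeasurableSet (L F) := by
  let _ : UniformSpace F := ⊥
  have : DiscreteTopology F := ⟨rfl⟩
  have h : L F = ⋂ i : ℤ, ⋂ _ : i < 1, {f : F⸨X⸩ | f.coeff i = 0} := by
    ext f
    simp [mem_L_iff]
  rw [h]
  refine IsClosed.measurableSet (isClosed_iInter fun i => isClosed_iInter fun _ => ?_)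
  exact (isClosed_discrete ({0} : Set F)).preimage
    (LaurentSeries.uniformContinuous_coeff i).continuous

/-- `μ_G(E × {n})` for measurable `E ⊆ 𝕃`. -/
theorem muG_prod_singleton (F : Type*) [Field F] [Fintype F] (E : Set (L F))
    (hE : MeasurableSet E) (n : ℤ) :
    muG F (E ×ˢ {n}) =
      ENNReal.ofReal (weight (Fintype.card F) n) * haar F (Subtype.val '' E) := by
  unfold muG
  rw [Measure.sum_apply _ (hE.prod (measurableSet_singleton n)), tsum_eq_single n]
  · rw [Measure.smul_apply, Measure.map_apply (by fun_prop) (hE.prod (measurableSet_singleton n)),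
      (MeasurableEmbedding.subtype_coe (measurableSet_L F)).comap_apply, smul_eq_mul]
    congr 3
    ext f
    simp
  · intro m hm
    rw [Measure.smul_apply, Measure.map_apply (by fun_prop) (hE.prod (measurableSet_singleton n))]
    have : (fun f : L F => (f, m)) ⁻¹' (E ×ˢ {n}) = ∅ := by
      ext f
      simp [hm]
    simp [this]

end GeometricFarey

end

/-!
Write `q` for the number of elements of `F`, `X = t⁻¹`, and `μ` for the normalized Haar measure.

**Discs.** The discs `g + X ^ m 𝒪` form a countable π-system generating the Borel sets, and
`μ (g + X ^ m 𝒪) = q ^ (-m)`. Identities between measures are therefore checked on discs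
(`ext_of_discs`); it even suffices to look at small discs. In this way one gets the behaviour of `μ`
under `f ↦ t f` (`haar_preimage_t_mul`) and under `f ↦ 1 / f` on the spheres `|f| = q ^ (-d)`
(`haar_preimage_inv`), because inversion maps a disc contained in a sphere to a disc.

**Invariance.** For `E ⊆ 𝕃` let `periodization E` be the set of series with fractional part in `E`.
Since `𝒪` is a union of `q` translates of `𝕃` by polynomials, `periodization E` meets `𝒪` in measure
`q μ(E)`, and the unit sphere in measure `(q - 1) μ(E)`. Hence the preimage of `E × {m}` has the same
measure as `E × {m}`, level by level: a negative level `m` receives the shift from level `m - 1`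
and the inversion from level `-m - 1`, a non-negative level only a shift
(`muG_preimage_prod_singleton`).

**Ergodicity.** Almost every orbit visits level `0`, and the first return to level `0` is the
continued fraction map `f ↦ 1 / f - [1 / f]`. So it is enough to show that a set `E ⊆ 𝕃` which is
invariant under this map is null or conull. Such a set has the same density in every disc
(`haar_periodization_inter_disc`), by induction on the level `m` of the disc: inversion maps a disc
of level `m` on which `|f| = q ^ (-d)`, `0 < d < m`, to a disc of the smaller level `m - 2 d`,
whose intersection with the periodization of `E` is known by induction; translation by polynomials
and taking complements in a disc of level `m - 1` give the remaining discs. A set of constant density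
`c` in all discs satisfies `μ (A ∩ E) = c μ (A)` for all measurable `A`, and `A = Eᶜ` gives the
zero-one law (`haar_periodization_eq_zero_or`).
-/

noncomputable section

namespace GeometricFarey

/-! ### Discs in the field of Laurent series -/

section Discs

variable {F : Type*} [Field F]

/-- The closed disc `{f : |f - g| ≤ q ^ (-m)}`, i.e. the coset `g + X ^ m 𝒪`. -/
def disc (g : F⸨X⸩) (m : ℤ) : Set F⸨X⸩ := {f | Valued.v (f - g) ≤ (WithZero.exp (-m) : ℤᵐ⁰)}

theorem mem_disc {f g : F⸨X⸩} {m : ℤ} :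
    f ∈ disc g m ↔ Valued.v (f - g) ≤ (WithZero.exp (-m) : ℤᵐ⁰) := Iff.rfl

theorem mem_disc_iff_coeff {f g : F⸨X⸩} {m : ℤ} :
    f ∈ disc g m ↔ ∀ i < m, f.coeff i = g.coeff i := by
  rw [mem_disc, LaurentSeries.valuation_le_iff_coeff_lt_eq_zero]
  simp [sub_eq_zero]

theorem self_mem_disc (g : F⸨X⸩) (m : ℤ) : g ∈ disc g m := by simp [mem_disc]

theorem disc_eq_of_mem {f g : F⸨X⸩} {m : ℤ} (h : f ∈ disc g m) : disc f m = disc g m := by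
  rw [mem_disc_iff_coeff] at h
  ext x
  simp only [mem_disc_iff_coeff]
  exact forall₂_congr fun i hi => by rw [h i hi]

theorem disc_subset_disc {g : F⸨X⸩} {m n : ℤ} (h : m ≤ n) : disc g n ⊆ disc g m := fun f hf => by
  rw [mem_disc_iff_coeff] at hf ⊢
  exact fun i hi => hf i (hi.trans_le h)

theorem coeff_t_zpow_mul (f : F⸨X⸩) (k i : ℤ) : (t F ^ k * f).coeff i = f.coeff (i + k) := by
  have h : t F ^ k = HahnSeries.single (-k) 1 := by
    rw [RatFunc.single_zpow, zpow_neg, ← inv_zpow, t, RatFunc.single_zpow, zpow_neg_one]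
  rw [h, HahnSeries.coeff_single_mul, sub_neg_eq_add, one_mul]

theorem t_ne_zero : t F ≠ 0 := by simp [t]

theorem v_t : Valued.v (t F) = (WithZero.exp (1 : ℤ) : ℤᵐ⁰) := by
  simpa [t] using LaurentSeries.valuation_single_zpow F (-1)

theorem v_t_zpow (k : ℤ) : Valued.v (t F ^ k) = (WithZero.exp k : ℤᵐ⁰) := by
  rw [map_zpow₀, v_t, ← WithZero.exp_zsmul]
  simp

theorem disc_eq_preimage_O (g : F⸨X⸩) (m : ℤ) : disc g m = (fun f => t F ^ m * (f - g)) ⁻¹' O F := by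
  ext f
  rw [Set.mem_preimage, mem_O_iff, map_mul, v_t_zpow, mem_disc, WithZero.exp_neg,
    ← mul_le_mul_iff_right₀ (WithZero.exp_pos (a := m)), mul_inv_cancel₀ (WithZero.exp_ne_zero)]

theorem O_eq_disc : O F = disc (0 : F⸨X⸩) 0 := by simp [disc_eq_preimage_O]

theorem mem_L_iff_disc {f : F⸨X⸩} : f ∈ L F ↔ f ∈ disc 0 1 := by
  simp [mem_L_iff, mem_disc_iff_coeff]

theorem isOpen_disc (g : F⸨X⸩) (m : ℤ) : IsOpen (disc g m) := by
  rw [disc_eq_preimage_O]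
  exact (isOpen_O F).preimage (by fun_prop)

theorem measurableSet_disc (g : F⸨X⸩) (m : ℤ) : MeasurableSet (disc g m) :=
  (isOpen_disc g m).measurableSet

theorem exists_disc_subset {x : F⸨X⸩} {U : Set F⸨X⸩} (hU : U ∈ 𝓝 x) (M : ℤ) :
    ∃ m, M ≤ m ∧ disc x m ⊆ U := by
  obtain ⟨γ, hγ⟩ := Valued.mem_nhds.mp hU
  set D : ℤ := -(WithZero.log (MonoidWithZeroHom.ValueGroup₀.embedding γ.1) - 1) with hD₀
  have hD : WithZero.exp (-D) < MonoidWithZeroHom.ValueGroup₀.embedding γ.1 := by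
    rw [← WithZero.lt_log_iff_exp_lt (by simp), hD₀]
    simp
  refine ⟨max M D, le_max_left _ _, fun f hf => ?_⟩
  suffices h : f ∈ {y : F⸨X⸩ |
      Valued.v (y - x) < MonoidWithZeroHom.ValueGroup₀.embedding γ.1} by
    simp_rw [← Valued.v.restrict_lt_iff_lt_embedding] at h
    exact hγ h
  exact (disc_subset_disc (le_max_right M D) hf).trans_lt hD

/-- The discs of radius at most `q ^ (-M)`, together with the empty set. -/
def discs (F : Type*) [Field F] (M : ℤ) : Set (Set F⸨X⸩) :=
  insert ∅ {s | ∃ g m, M ≤ m ∧ s = disc g m}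

theorem disc_mem_discs (g : F⸨X⸩) {m M : ℤ} (h : M ≤ m) : disc g m ∈ discs F M :=
  Or.inr ⟨g, m, h, rfl⟩

/-- In an ultrametric space two discs are nested or disjoint. -/
theorem isPiSystem_discs (M : ℤ) : IsPiSystem (discs F M) := by
  rintro _ (rfl | ⟨g, m, hm, rfl⟩) _ (rfl | ⟨g', m', hm', rfl⟩) ⟨x, hx, hx'⟩
  · exact hx.elim
  · exact hx.elim
  · exact hx'.elim
  · rw [← disc_eq_of_mem hx, ← disc_eq_of_mem hx']
    rcases le_total m m' with h | h
    · rw [Set.inter_eq_right.mpr (disc_subset_disc h)]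
      exact disc_mem_discs _ hm'
    · rw [Set.inter_eq_left.mpr (disc_subset_disc h)]
      exact disc_mem_discs _ hm

theorem isTopologicalBasis_discs (M : ℤ) : TopologicalSpace.IsTopologicalBasis (discs F M) := by
  refine TopologicalSpace.isTopologicalBasis_of_isOpen_of_nhds ?_ fun x U hx hU => ?_
  · rintro _ (rfl | ⟨g, m, -, rfl⟩)
    · exact isOpen_empty
    · exact isOpen_disc g m
  · obtain ⟨m, hm, h⟩ := exists_disc_subset (hU.mem_nhds hx) M
    exact ⟨_, disc_mem_discs x hm, self_mem_disc x m, h⟩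

theorem countable_range_disc [Finite F] (m : ℤ) :
    (Set.range fun g : F⸨X⸩ => disc g m).Countable := by
  -- A disc is determined by the coefficients of its centre in a window `[n, m)`.
  have hfin : ∀ n : ℤ, {h : F⸨X⸩ | ∀ i, i ∉ Set.Ico n m → h.coeff i = 0}.Finite := by
    intro n
    refine Set.Finite.of_injOn (f := fun h (i : Set.Ico n m) => h.coeff i) (t := Set.univ)
      (Set.mapsTo_univ _ _) ?_ Set.finite_univ
    intro a ha b hb hab
    ext i
    by_cases hi : i ∈ Set.Ico n m
    · exact congrFun hab ⟨i, hi⟩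
    · rw [ha i hi, hb i hi]
  refine ((Set.countable_iUnion fun n => (hfin n).countable).image fun g => disc g m).mono ?_
  rintro _ ⟨g, rfl⟩
  refine ⟨HahnSeries.truncLT m g, Set.mem_iUnion.mpr ⟨g.order, fun i hi => ?_⟩, ?_⟩
  · by_cases h : i < m
    · have : i < g.order := by
        by_contra hc
        exact hi ⟨not_lt.mp hc, h⟩
      simp [HahnSeries.truncLT, HahnSeries.coeff_eq_zero_of_lt_order this]
    · simp [HahnSeries.truncLT, h]
  · refine disc_eq_of_mem (mem_disc_iff_coeff.mpr fun i hi => ?_)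
    simp [HahnSeries.truncLT, hi]

theorem countable_discs [Finite F] (M : ℤ) : (discs F M).Countable := by
  refine Set.Countable.insert _
    ((Set.countable_iUnion fun m : ℤ => countable_range_disc (F := F) m).mono ?_)
  rintro _ ⟨g, m, -, rfl⟩
  exact Set.mem_iUnion.mpr ⟨m, g, rfl⟩

/-- A measure that is finite on discs is determined by its values on small discs. -/
theorem ext_of_discs [Finite F] {μ ν : Measure F⸨X⸩} (M : ℤ) (hfin : ∀ g, μ (disc g M) ≠ ∞)
    (h : ∀ g m, M ≤ m → μ (disc g m) = ν (disc g m)) : μ = ν := by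
  have : SecondCountableTopology F⸨X⸩ :=
    (isTopologicalBasis_discs 0).secondCountableTopology (countable_discs 0)
  have hd : ∀ s ∈ discs F M, μ s = ν s := by
    rintro _ (rfl | ⟨g, m, hm, rfl⟩)
    · simp
    · exact h g m hm
  refine Measure.ext_of_generateFrom_of_cover (S := discs F M)
    (T := Set.range fun g : F⸨X⸩ => disc g M)
    ((isTopologicalBasis_discs M).borel_eq_generateFrom) (countable_range_disc M)
    (isPiSystem_discs M) ?_ ?_ ?_ ?_
  · exact Set.eq_univ_of_forall fun x => ⟨_, ⟨x, rfl⟩, self_mem_disc x M⟩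
  · rintro _ ⟨g, rfl⟩
    exact hfin g
  · rintro _ ⟨g, rfl⟩ s hs
    rcases (s ∩ disc g M).eq_empty_or_nonempty with he | hne
    · simp [he]
    · exact hd _ (isPiSystem_discs M s hs _ (disc_mem_discs g le_rfl) hne)
  · rintro _ ⟨g, rfl⟩
    exact h g M le_rfl

/-- A disc is the disjoint union of `q` discs of the next smaller radius. -/
theorem disc_eq_iUnion (g : F⸨X⸩) (m : ℤ) :
    disc g m = ⋃ a : F, disc (g + HahnSeries.single m a) (m + 1) := by
  ext f
  simp only [Set.mem_iUnion, mem_disc_iff_coeff]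
  constructor
  · refine fun h => ⟨f.coeff m - g.coeff m, fun i hi => ?_⟩
    rcases (Int.lt_add_one_iff.mp hi).lt_or_eq with hi | rfl
    · rw [h i hi, HahnSeries.coeff_add, HahnSeries.coeff_single_of_ne hi.ne, add_zero]
    · simp
  · rintro ⟨a, h⟩ i hi
    rw [h i (by omega), HahnSeries.coeff_add, HahnSeries.coeff_single_of_ne hi.ne, add_zero]

theorem pairwise_disjoint_disc (g : F⸨X⸩) (m : ℤ) : Pairwise
    (Function.onFun Disjoint fun a : F => disc (g + HahnSeries.single m a) (m + 1)) := by
  intro a b hab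
  refine Set.disjoint_left.mpr fun f ha hb => hab ?_
  rw [mem_disc_iff_coeff] at ha hb
  simpa using (ha m (by omega)).symm.trans (hb m (by omega))

theorem measure_inter_disc [Fintype F] (μ : Measure F⸨X⸩) {A : Set F⸨X⸩} (hA : MeasurableSet A)
    (g : F⸨X⸩) (m : ℤ) :
    μ (A ∩ disc g m) = ∑ a : F, μ (A ∩ disc (g + HahnSeries.single m a) (m + 1)) := by
  rw [disc_eq_iUnion, Set.inter_iUnion, measure_iUnion, tsum_fintype]
  · exact fun a b hab => ((pairwise_disjoint_disc g m hab).mono Set.inter_subset_right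
      Set.inter_subset_right)
  · exact fun a => hA.inter (measurableSet_disc _ _)

end Discs

/-! ### Haar measure of discs, scaling and inversion -/

section Haar

variable {F : Type*} [Field F]

/-- The number of elements of the residue field, as an extended non-negative real. -/
abbrev resCard (F : Type*) [Fintype F] : ℝ≥0∞ := (Fintype.card F : ℝ≥0∞)

theorem resCard_ne_zero [Fintype F] : resCard F ≠ 0 := by simp

theorem resCard_ne_top {F : Type*} [Fintype F] : resCard F ≠ ∞ := ENNReal.natCast_ne_top _

instance [Finite F] : (haar F).IsAddLeftInvariant := by unfold haar; infer_instance

theorem resCard_mul_zpow [Fintype F] (m : ℤ) : resCard F * resCard F ^ m = resCard F ^ (m + 1) := by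
  rw [ENNReal.zpow_add resCard_ne_zero resCard_ne_top, zpow_one, mul_comm]

theorem resCard_zpow_mul_zpow [Fintype F] (m n : ℤ) :
    resCard F ^ m * resCard F ^ n = resCard F ^ (m + n) :=
  (ENNReal.zpow_add resCard_ne_zero resCard_ne_top m n).symm

theorem zpow_ne_zero_ne_top [Fintype F] (m : ℤ) : resCard F ^ m ≠ 0 ∧ resCard F ^ m ≠ ∞ :=
  ⟨(ENNReal.zpow_pos resCard_ne_zero resCard_ne_top m).ne',
    (ENNReal.zpow_lt_top resCard_ne_zero resCard_ne_top m).ne⟩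

theorem haar_translate_inter_disc [Finite F] (A : Set F⸨X⸩) (p g : F⸨X⸩) (m : ℤ)
    (hA : ∀ f, p + f ∈ A ↔ f ∈ A) : haar F (A ∩ disc (p + g) m) = haar F (A ∩ disc g m) := by
  rw [← measure_preimage_add (haar F) p]
  congr 1
  ext f
  simp [mem_disc, hA]

theorem haar_disc_zero [Fintype F] (m : ℤ) : haar F (disc 0 m) = resCard F ^ (-m) := by
  have hstep : ∀ m, haar F (disc 0 m) = resCard F * haar F (disc 0 (m + 1)) := by
    intro m
    have h := measure_inter_disc (haar F) MeasurableSet.univ (0 : F⸨X⸩) m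
    simp only [Set.univ_inter, zero_add] at h
    rw [h, Finset.sum_congr rfl (g := fun _ => haar F (disc 0 (m + 1)))]
    · simp
    · intro a _
      simpa using haar_translate_inter_disc Set.univ (HahnSeries.single m a) 0 (m + 1) (by simp)
  have h0 : haar F (disc 0 0) = 1 := by
    rw [← O_eq_disc]
    exact Measure.addHaarMeasure_self (K₀ := compactO F)
  induction m using Int.induction_on with
  | zero => simpa using h0
  | succ n ih =>
    rw [hstep, show (-(n : ℤ)) = -(n + 1) + 1 by ring, ← resCard_mul_zpow] at ih
    exact (ENNReal.mul_right_inj resCard_ne_zero resCard_ne_top).mp ih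
  | pred n ih =>
    rw [hstep, show (-(n : ℤ) - 1 + 1) = -n by ring, ih, resCard_mul_zpow]
    congr 1
    ring

theorem haar_disc [Fintype F] (g : F⸨X⸩) (m : ℤ) : haar F (disc g m) = resCard F ^ (-m) := by
  rw [← haar_disc_zero]
  simpa using haar_translate_inter_disc Set.univ g 0 m (by simp)

theorem haar_disc_ne_top [Fintype F] (g : F⸨X⸩) (m : ℤ) : haar F (disc g m) ≠ ∞ := by
  rw [haar_disc]
  exact (zpow_ne_zero_ne_top _).2

/-- Multiplication by `t` multiplies Haar measure by `q`. -/
theorem haar_preimage_t_mul [Fintype F] {A : Set F⸨X⸩} (hA : MeasurableSet A) :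
    haar F {f | t F * f ∈ A} = resCard F ^ (-1 : ℤ) * haar F A := by
  have hm : Measurable fun f : F⸨X⸩ => t F * f := measurable_const_mul _
  have key : (haar F).map (fun f => t F * f) = resCard F ^ (-1 : ℤ) • haar F := by
    have hp : ∀ g m, (haar F).map (fun f => t F * f) (disc g m) = resCard F ^ (-m - 1) := by
      intro g m
      rw [Measure.map_apply hm (measurableSet_disc _ _), ← neg_add', ← haar_disc ((t F)⁻¹ * g)]
      congr 1
      ext f
      have : t F * f - g = t F * (f - (t F)⁻¹ * g) := by
        rw [mul_sub, mul_inv_cancel_left₀ t_ne_zero]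
      rw [Set.mem_preimage, mem_disc, mem_disc, this, map_mul, v_t,
        show (-m : ℤ) = 1 + -(m + 1) by ring, WithZero.exp_add,
        mul_le_mul_iff_right₀ WithZero.exp_pos]
    refine ext_of_discs 0 (fun g => ?_) fun g m _ => ?_
    · rw [hp]
      exact (zpow_ne_zero_ne_top _).2
    · rw [hp, Measure.smul_apply, smul_eq_mul, haar_disc, resCard_zpow_mul_zpow]
      congr 1
      ring
  rw [← smul_eq_mul, ← Measure.smul_apply, ← key, Measure.map_apply hm hA]
  rfl

/-- The sphere `{f : |f| = q ^ (-d)}`. -/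
def sphere (F : Type*) [Field F] (d : ℤ) : Set F⸨X⸩ :=
  {f | Valued.v f = (WithZero.exp (-d) : ℤᵐ⁰)}

theorem mem_sphere {f : F⸨X⸩} {d : ℤ} :
    f ∈ sphere F d ↔ Valued.v f = (WithZero.exp (-d) : ℤᵐ⁰) := Iff.rfl

theorem exists_mem_sphere {f : F⸨X⸩} (hf : f ≠ 0) : ∃ d, f ∈ sphere F d :=
  ⟨-WithZero.log (Valued.v f), by rw [mem_sphere, neg_neg, WithZero.exp_log (by simpa using hf)]⟩

theorem sphere_eq_diff (d : ℤ) : sphere F d = disc 0 d \ disc 0 (d + 1) := by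
  ext f
  simp only [mem_sphere, Set.mem_sdiff, mem_disc, sub_zero, not_le]
  rcases eq_or_ne f 0 with rfl | hf
  · simp [WithZero.exp_ne_zero.symm]
  · have : (Valued.v f : ℤᵐ⁰) ≠ 0 := by simpa using hf
    rw [← WithZero.exp_log this, WithZero.exp_inj, WithZero.exp_le_exp, WithZero.exp_lt_exp]
    omega

theorem measurableSet_sphere (d : ℤ) : MeasurableSet (sphere F d) := by
  rw [sphere_eq_diff]
  exact (measurableSet_disc _ _).diff (measurableSet_disc _ _)

theorem ne_zero_of_mem_sphere {f : F⸨X⸩} {d : ℤ} (h : f ∈ sphere F d) : f ≠ 0 := by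
  rintro rfl
  simp [mem_sphere, WithZero.exp_ne_zero.symm] at h

theorem inv_mem_sphere {f : F⸨X⸩} {d : ℤ} : f⁻¹ ∈ sphere F (-d) ↔ f ∈ sphere F d := by
  rw [mem_sphere, mem_sphere, map_inv₀, WithZero.exp_neg (-d), inv_inj]

theorem disc_subset_sphere {g : F⸨X⸩} {d m : ℤ} (hg : g ∈ sphere F d) (h : d < m) :
    disc g m ⊆ sphere F d := fun f hf => by
  rw [mem_sphere] at hg ⊢
  rw [← hg]
  refine Valuation.map_eq_of_sub_lt _ (lt_of_le_of_lt hf ?_)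
  rw [hg, WithZero.exp_lt_exp]
  omega

/-- On a sphere, inversion maps discs to discs. -/
theorem inv_mem_disc_inv {f g : F⸨X⸩} {d : ℤ} (hf : f ∈ sphere F d) (hg : g ∈ sphere F d) (m : ℤ) :
    f⁻¹ ∈ disc g⁻¹ m ↔ f ∈ disc g (m + 2 * d) := by
  have hf0 := ne_zero_of_mem_sphere hf
  have hg0 := ne_zero_of_mem_sphere hg
  have h : f - g = (f * g) * -(f⁻¹ - g⁻¹) := by field_simp; ring
  rw [mem_sphere] at hf hg
  rw [mem_disc, mem_disc, h, map_mul, map_mul, Valuation.map_neg, hf, hg, ← WithZero.exp_add,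
    show -(m + 2 * d) = (-d + -d) + -m by ring, WithZero.exp_add (-d + -d),
    mul_le_mul_iff_right₀ WithZero.exp_pos]

/-- Inversion maps the sphere of radius `q ^ (-d)` to that of radius `q ^ d`, and scales Haar
measure by `q ^ (2 * d)`. -/
theorem haar_preimage_inv [Fintype F] (d : ℤ) {A : Set F⸨X⸩} (hA : MeasurableSet A) :
    haar F ({f | f⁻¹ ∈ A} ∩ sphere F d) = resCard F ^ (-2 * d) * haar F (A ∩ sphere F (-d)) := by
  have hm : Measurable fun f : F⸨X⸩ => f⁻¹ := measurable_inv
  have key : ((haar F).restrict (sphere F d)).map (fun f => f⁻¹) =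
      resCard F ^ (-2 * d) • (haar F).restrict (sphere F (-d)) := by
    have hmap : ∀ g m, ((haar F).restrict (sphere F d)).map (fun f => f⁻¹) (disc g m) =
        haar F ((fun f => f⁻¹) ⁻¹' disc g m ∩ sphere F d) := fun g m => by
      rw [Measure.map_apply hm (measurableSet_disc _ _),
        Measure.restrict_apply (hm (measurableSet_disc _ _))]
    -- Discs of radius less than `q ^ d` are contained in or disjoint from the sphere.
    have hdisj : ∀ (g : F⸨X⸩) (m : ℤ), -d + 1 ≤ m → g ∉ sphere F (-d) →
        disc g m ∩ sphere F (-d) = ∅ := by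
      intro g m h hg
      refine Set.eq_empty_of_forall_notMem fun f hf => hg ?_
      have hgf : g ∈ disc f m := (disc_eq_of_mem hf.1).symm ▸ self_mem_disc g m
      exact disc_subset_sphere hf.2 (by omega) hgf
    refine ext_of_discs (-d + 1) (fun g => ?_) fun g m h => ?_
    · rw [hmap]
      refine ne_top_of_le_ne_top (haar_disc_ne_top 0 d) (measure_mono ?_)
      rw [sphere_eq_diff]
      exact Set.inter_subset_right.trans Set.sdiff_subset
    · rw [hmap, Measure.smul_apply, Measure.restrict_apply (measurableSet_disc _ _), smul_eq_mul]
      by_cases hg : g ∈ sphere F (-d)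
      · have hg' : g⁻¹ ∈ sphere F d := by simpa using inv_mem_sphere.mpr hg
        have : (fun f => f⁻¹) ⁻¹' disc g m ∩ sphere F d = disc g⁻¹ (m + 2 * d) := by
          ext f
          constructor
          · rintro ⟨h1, h2⟩
            rwa [Set.mem_preimage, ← inv_inv g, inv_mem_disc_inv h2 hg'] at h1
          · intro h1
            have h2 := disc_subset_sphere hg' (by omega) h1
            rw [← inv_mem_disc_inv h2 hg', inv_inv] at h1
            exact ⟨h1, h2⟩
        rw [this, Set.inter_eq_left.mpr (disc_subset_sphere hg (by omega)), haar_disc, haar_disc,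
          resCard_zpow_mul_zpow]
        congr 1
        ring
      · have : (fun f => f⁻¹) ⁻¹' disc g m ∩ sphere F d = ∅ := by
          refine Set.eq_empty_of_forall_notMem fun f hf => ?_
          have : f⁻¹ ∈ disc g m ∩ sphere F (-d) := ⟨hf.1, inv_mem_sphere.mpr hf.2⟩
          simp [hdisj g m h hg] at this
        rw [this, hdisj g m h hg]
        simp
  have h := congrArg (fun μ => μ A) key
  rwa [Measure.map_apply hm hA, Measure.restrict_apply (hm hA), Measure.smul_apply,
    Measure.restrict_apply hA, smul_eq_mul] at h

end Haar

/-! ### Fractional parts and periodic sets -/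

section Frac

variable {F : Type*} [Field F]

theorem coeff_frac (f : F⸨X⸩) (i : ℤ) :
    (frac f : F⸨X⸩).coeff i = if i < 1 then 0 else f.coeff i := by
  simp only [frac, polyPart, HahnSeries.truncLT, HahnSeries.coeff_sub]
  split_ifs with h <;> simp [h]

theorem frac_eq_frac_iff {f g : F⸨X⸩} : frac f = frac g ↔ ∀ i, 1 ≤ i → f.coeff i = g.coeff i := by
  rw [Subtype.ext_iff, HahnSeries.ext_iff, funext_iff]
  refine forall_congr' fun i => ?_
  rw [coeff_frac, coeff_frac]
  split_ifs with h
  · simp [h]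
  · simp [not_lt.mp h]

theorem frac_coe (f : L F) : frac (f : F⸨X⸩) = f := by
  ext i
  rw [coeff_frac]
  split_ifs with h
  · exact ((mem_L_iff _).mp f.2 i h).symm
  · rfl

theorem frac_t_zpow_mul_frac {k : ℤ} (hk : 0 ≤ k) (h : F⸨X⸩) :
    frac (t F ^ k * (frac h : F⸨X⸩)) = frac (t F ^ k * h) := by
  rw [frac_eq_frac_iff]
  intro i hi
  rw [coeff_t_zpow_mul, coeff_t_zpow_mul, coeff_frac, if_neg (by omega)]

theorem continuous_frac : Continuous (frac : F⸨X⸩ → L F) := by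
  refine Continuous.subtype_mk (continuous_id.sub (IsLocallyConstant.continuous ?_)) _
  refine (IsLocallyConstant.iff_exists_open _).mpr fun f =>
    ⟨disc f 1, isOpen_disc f 1, self_mem_disc f 1, fun g hg => ?_⟩
  rw [mem_disc_iff_coeff] at hg
  ext i
  simp only [polyPart, HahnSeries.truncLT]
  by_cases h : i < 1
  · simp [h, hg i h]
  · simp [h]

/-- The set of series with fractional part in `E`; it is invariant under translation by
polynomials. -/
def periodization (E : Set (L F)) : Set F⸨X⸩ := frac ⁻¹' E

theorem mem_periodization {E : Set (L F)} {f : F⸨X⸩} : f ∈ periodization E ↔ frac f ∈ E := Iff.rfl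

theorem coe_mem_periodization {E : Set (L F)} {f : L F} : (f : F⸨X⸩) ∈ periodization E ↔ f ∈ E := by
  rw [mem_periodization, frac_coe]

theorem measurableSet_periodization {E : Set (L F)} (hE : MeasurableSet E) :
    MeasurableSet (periodization E) :=
  continuous_frac.measurable hE

theorem image_val_eq (E : Set (L F)) : Subtype.val '' E = periodization E ∩ disc 0 1 := by
  ext f
  constructor
  · rintro ⟨f, hf, rfl⟩
    exact ⟨coe_mem_periodization.mpr hf, mem_L_iff_disc.mp f.2⟩
  · rintro ⟨h, hL⟩
    exact ⟨⟨f, mem_L_iff_disc.mpr hL⟩, coe_mem_periodization.mp h, rfl⟩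

theorem haar_periodization_inter_disc_add [Finite F] (E : Set (L F)) {p : F⸨X⸩}
    (hp : ∀ i, 1 ≤ i → p.coeff i = 0) (g : F⸨X⸩) (m : ℤ) :
    haar F (periodization E ∩ disc (p + g) m) = haar F (periodization E ∩ disc g m) := by
  refine haar_translate_inter_disc _ _ _ _ fun f => ?_
  rw [mem_periodization, mem_periodization, frac_eq_frac_iff.mpr fun i hi => ?_]
  rw [HahnSeries.coeff_add, hp i hi, zero_add]

theorem haar_periodization_inter_disc_frac [Finite F] (E : Set (L F)) (g : F⸨X⸩) (m : ℤ) :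
    haar F (periodization E ∩ disc (frac g : F⸨X⸩) m) = haar F (periodization E ∩ disc g m) := by
  conv_rhs => rw [← add_sub_cancel (polyPart g) g]
  refine (haar_periodization_inter_disc_add E (fun i hi => ?_) _ m).symm
  simp [polyPart, HahnSeries.truncLT, not_lt.mpr hi]

/-- A disc of radius at least that of `𝕃` is a union of translates of `𝕃` by polynomials. -/
theorem haar_periodization_inter_disc_of_le [Fintype F] {E : Set (L F)} (hE : MeasurableSet E)
    (g : F⸨X⸩) {m : ℤ} (hm : m ≤ 1) :
    haar F (periodization E ∩ disc g m) =
      resCard F ^ (1 - m) * haar F (periodization E ∩ disc 0 1) := by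
  induction m, hm using Int.leInductionDown generalizing g with
  | base =>
    rw [← haar_periodization_inter_disc_frac,
      ← disc_eq_of_mem (mem_L_iff_disc.mp (frac g).2)]
    simp
  | pred m hm ih =>
    rw [measure_inter_disc _ (measurableSet_periodization hE), sub_add_cancel]
    simp_rw [ih]
    rw [Finset.sum_const, Finset.card_univ, nsmul_eq_mul, ← mul_assoc, resCard_mul_zpow]
    congr 2
    ring

theorem deg_lt_neg_one_iff (f : F⸨X⸩) : deg f < ((-1 : ℤ) : WithBot ℤ) ↔ f ∈ disc 0 2 := by
  have h := deg_le_iff f (-2)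
  rw [neg_neg] at h
  have h' : f ∈ disc 0 2 ↔ ∀ i < 2, f.coeff i = 0 := by simp [mem_disc_iff_coeff]
  rw [h', ← h]
  unfold deg
  split_ifs
  · simp
  · rw [WithBot.coe_lt_coe, WithBot.coe_le_coe]
    omega

theorem fareyMap_apply_of_neg {n : ℤ} (hn : n < 0) (f : L F) :
    fareyMap F (f, n) = (frac (t F * (f : F⸨X⸩)), n + 1) := by
  simp [fareyMap, hn]

theorem fareyMap_apply_of_mem {f : L F} (hf : (f : F⸨X⸩) ∈ disc 0 2) (n : ℤ) :
    fareyMap F (f, n) = (frac (t F * (f : F⸨X⸩)), n + 1) := by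
  simp [fareyMap, (deg_lt_neg_one_iff (f : F⸨X⸩)).mpr hf]

theorem fareyMap_apply_of_notMem {f : L F} (hf : (f : F⸨X⸩) ∉ disc 0 2) {n : ℤ} (hn : 0 ≤ n) :
    fareyMap F (f, n) = (frac (t F * (f : F⸨X⸩))⁻¹, -(n + 1)) := by
  rw [← deg_lt_neg_one_iff] at hf
  unfold fareyMap
  rw [if_neg (not_or.mpr ⟨hf, not_lt.mpr hn⟩), one_div]

theorem measurable_fareyMap : Measurable (fareyMap F) := by
  refine measurable_from_prod_countable_left fun n => ?_
  simp only [fareyMap]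
  have ht : Measurable fun f : L F => t F * (f : F⸨X⸩) :=
    measurable_subtype_coe.const_mul (t F)
  refine Measurable.ite ?_ ?_ ?_
  · simp only [deg_lt_neg_one_iff]
    exact (measurable_subtype_coe (measurableSet_disc (0 : F⸨X⸩) 2)).union (MeasurableSet.const _)
  · exact (continuous_frac.measurable.comp ht).prodMk measurable_const
  · simp only [one_div]
    exact (continuous_frac.measurable.comp ht.inv).prodMk measurable_const

end Frac

/-! ### Invariance of the measure -/

section Invariance

variable {F : Type*} [Field F]

theorem t_mul_mem_disc_zero {f : F⸨X⸩} {m : ℤ} : t F * f ∈ disc 0 m ↔ f ∈ disc 0 (m + 1) := by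
  rw [mem_disc, mem_disc, sub_zero, sub_zero, map_mul, v_t,
    show (-m : ℤ) = 1 + -(m + 1) by ring, WithZero.exp_add,
    mul_le_mul_iff_right₀ WithZero.exp_pos]

theorem weight_neg_sub_one (q : ℕ) (n : ℤ) : weight q (-n - 1) = weight q n := by
  unfold weight
  split_ifs with h1 h2 h2
  · omega
  · rfl
  · rw [show -(-n - 1) - 1 = n by ring]
  · omega

theorem weight_pos {q : ℕ} (hq : 1 < q) (n : ℤ) : 0 < weight q n := by
  have : (1 : ℝ) < q := by exact_mod_cast hq
  unfold weight
  split_ifs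
  · have : (0 : ℝ) < (q : ℝ) - 1 := by linarith
    positivity
  · have : (0 : ℝ) < (q : ℝ) - 1 := by linarith
    positivity

/-- The weight of level `n` as an extended non-negative real. -/
abbrev levelWeight (F : Type*) [Fintype F] (n : ℤ) : ℝ≥0∞ :=
  ENNReal.ofReal (weight (Fintype.card F) n)

theorem levelWeight_neg_sub_one {F : Type*} [Fintype F] (n : ℤ) :
    levelWeight F (-n - 1) = levelWeight F n := by
  rw [levelWeight, weight_neg_sub_one]

theorem levelWeight_succ [Fintype F] {n : ℤ} (hn : 0 ≤ n) :
    levelWeight F n * resCard F ^ (-1 : ℤ) = levelWeight F (n + 1) := by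
  have hq : (0 : ℝ) < Fintype.card F := by exact_mod_cast Fintype.card_pos
  have h1 : resCard F ^ (-1 : ℤ) = ENNReal.ofReal ((Fintype.card F : ℝ)⁻¹) := by
    rw [zpow_neg_one, ENNReal.ofReal_inv_of_pos hq, ENNReal.ofReal_natCast]
  rw [h1, levelWeight, ← ENNReal.ofReal_mul (weight_pos Fintype.one_lt_card n).le, levelWeight]
  congr 1
  rw [weight, weight, if_pos hn, if_pos (by omega), zpow_add_one₀ hq.ne']
  field_simp

theorem haar_image_shift [Fintype F] {E : Set (L F)} (hE : MeasurableSet E) :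
    haar F (Subtype.val '' {f : L F | frac (t F * (f : F⸨X⸩)) ∈ E}) =
      haar F (periodization E ∩ disc 0 1) := by
  have : Subtype.val '' {f : L F | frac (t F * (f : F⸨X⸩)) ∈ E} =
      {f | t F * f ∈ periodization E ∩ disc 0 0} := by
    ext f
    simp only [Set.mem_image, Set.mem_ofPred_eq, Set.mem_inter_iff, t_mul_mem_disc_zero,
      mem_periodization, zero_add, ← mem_L_iff_disc]
    constructor
    · rintro ⟨f, hf, rfl⟩
      exact ⟨hf, f.2⟩
    · rintro ⟨h, hL⟩
      exact ⟨⟨f, hL⟩, h, rfl⟩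
  have hP := measurableSet_periodization hE
  rw [this, haar_preimage_t_mul (hP.inter (measurableSet_disc _ _)),
    haar_periodization_inter_disc_of_le hE 0 zero_le_one, ← mul_assoc, resCard_zpow_mul_zpow]
  simp

theorem haar_image_shift_of_mem [Fintype F] {E : Set (L F)} (hE : MeasurableSet E) :
    haar F (Subtype.val '' {f : L F | (f : F⸨X⸩) ∈ disc 0 2 ∧ frac (t F * (f : F⸨X⸩)) ∈ E}) =
      resCard F ^ (-1 : ℤ) * haar F (periodization E ∩ disc 0 1) := by
  have : Subtype.val '' {f : L F | (f : F⸨X⸩) ∈ disc 0 2 ∧ frac (t F * (f : F⸨X⸩)) ∈ E} =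
      {f | t F * f ∈ periodization E ∩ disc 0 1} := by
    ext f
    simp only [Set.mem_image, Set.mem_ofPred_eq, Set.mem_inter_iff, t_mul_mem_disc_zero,
      mem_periodization, one_add_one_eq_two]
    constructor
    · rintro ⟨f, hf, rfl⟩
      exact hf.symm
    · rintro ⟨h, h2⟩
      exact ⟨⟨f, mem_L_iff_disc.mpr (disc_subset_disc one_le_two h2)⟩, ⟨h2, h⟩, rfl⟩
  rw [this, haar_preimage_t_mul ((measurableSet_periodization hE).inter (measurableSet_disc _ _))]

theorem haar_image_inv_of_notMem [Fintype F] {E : Set (L F)} (hE : MeasurableSet E) :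
    haar F (Subtype.val '' {f : L F | (f : F⸨X⸩) ∉ disc 0 2 ∧ frac (t F * (f : F⸨X⸩))⁻¹ ∈ E}) =
      resCard F ^ (-1 : ℤ) * haar F (periodization E ∩ sphere F 0) := by
  have : Subtype.val '' {f : L F | (f : F⸨X⸩) ∉ disc 0 2 ∧ frac (t F * (f : F⸨X⸩))⁻¹ ∈ E} =
      {f | t F * f ∈ {g | g⁻¹ ∈ periodization E} ∩ sphere F 0} := by
    ext f
    simp only [Set.mem_image, Set.mem_ofPred_eq, Set.mem_inter_iff, sphere_eq_diff, Set.mem_sdiff,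
      t_mul_mem_disc_zero, mem_periodization, zero_add, one_add_one_eq_two, ← mem_L_iff_disc]
    constructor
    · rintro ⟨f, hf, rfl⟩
      exact ⟨hf.2, f.2, hf.1⟩
    · rintro ⟨h, hL, h2⟩
      exact ⟨⟨f, hL⟩, ⟨h2, h⟩, rfl⟩
  have hP := measurableSet_periodization hE
  rw [this, haar_preimage_t_mul (.inter (s₁ := {g | g⁻¹ ∈ periodization E})
      (measurable_inv hP) (measurableSet_sphere _)),
    haar_preimage_inv 0 hP]
  simp

/-- The unit sphere is the complement of `𝕃` in `𝒪`, and `𝒪` is made of `q` translates of `𝕃`. -/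
theorem haar_periodization_add_sphere [Fintype F] {E : Set (L F)} (hE : MeasurableSet E) :
    haar F (periodization E ∩ disc 0 1) + haar F (periodization E ∩ sphere F 0) =
      resCard F * haar F (periodization E ∩ disc 0 1) := by
  have h := haar_periodization_inter_disc_of_le hE (0 : F⸨X⸩) zero_le_one
  rw [sub_zero, zpow_one] at h
  rw [← h, ← measure_union _ ((measurableSet_periodization hE).inter (measurableSet_sphere _)),
    ← Set.inter_union_distrib_left, sphere_eq_diff, zero_add,
    Set.union_sdiff_cancel (disc_subset_disc zero_le_one)]
  rw [sphere_eq_diff, zero_add]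
  exact (Set.disjoint_sdiff_right).mono Set.inter_subset_right Set.inter_subset_right

theorem muG_prod_singleton' [Fintype F] {E : Set (L F)} (hE : MeasurableSet E) (n : ℤ) :
    muG F (E ×ˢ {n}) = levelWeight F n * haar F (periodization E ∩ disc 0 1) := by
  rw [muG_prod_singleton F E hE n, image_val_eq]

theorem muG_preimage_prod_singleton [Fintype F] {E : Set (L F)} (hE : MeasurableSet E) (m : ℤ) :
    muG F (fareyMap F ⁻¹' (E ×ˢ {m})) = muG F (E ×ˢ {m}) := by
  have ht : Measurable fun f : L F => t F * (f : F⸨X⸩) :=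
    measurable_subtype_coe.const_mul (t F)
  have hd : MeasurableSet {f : L F | (f : F⸨X⸩) ∈ disc 0 2} :=
    measurable_subtype_coe (measurableSet_disc 0 2)
  have hS : MeasurableSet {f : L F | frac (t F * (f : F⸨X⸩)) ∈ E} :=
    (continuous_frac.measurable.comp ht) hE
  have hI : MeasurableSet {f : L F | frac (t F * (f : F⸨X⸩))⁻¹ ∈ E} :=
    (continuous_frac.measurable.comp ht.inv) hE
  rw [muG_prod_singleton' hE]
  rcases lt_trichotomy m 0 with hm | rfl | hm
  · -- A negative level is entered by a shift from below and by an inversion from above.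
    have : fareyMap F ⁻¹' (E ×ˢ {m}) = {f : L F | frac (t F * (f : F⸨X⸩)) ∈ E} ×ˢ {m - 1} ∪
        {f : L F | (f : F⸨X⸩) ∉ disc 0 2 ∧ frac (t F * (f : F⸨X⸩))⁻¹ ∈ E} ×ˢ {-m - 1} := by
      ext ⟨f, n⟩
      simp only [Set.mem_preimage, Set.mem_prod, Set.mem_singleton_iff, Set.mem_union,
        Set.mem_ofPred_eq]
      rcases lt_or_ge n 0 with hn | hn
      · rw [fareyMap_apply_of_neg hn, ← eq_sub_iff_add_eq, or_iff_left]
        rintro ⟨-, rfl⟩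
        omega
      · have h1 : ¬ n = m - 1 := by omega
        by_cases hf : (f : F⸨X⸩) ∈ disc 0 2
        · have h2 : ¬ n + 1 = m := by omega
          simp [fareyMap_apply_of_mem hf, hf, h1, h2]
        · have h2 : -(n + 1) = m ↔ n = -m - 1 := by omega
          simp only [fareyMap_apply_of_notMem hf hn, hf, h1, h2, not_false_eq_true, true_and,
            and_false, false_or]
    have hN : MeasurableSet {f : L F | (f : F⸨X⸩) ∉ disc 0 2 ∧ frac (t F * (f : F⸨X⸩))⁻¹ ∈ E} :=
      hd.compl.inter hI
    rw [this, measure_union _ (hN.prod (measurableSet_singleton _)),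
      muG_prod_singleton F _ hS, muG_prod_singleton F _ hN, haar_image_shift hE,
      haar_image_inv_of_notMem hE]
    · change levelWeight F (m - 1) * _ + levelWeight F (-m - 1) * _ = _
      rw [← levelWeight_neg_sub_one (m - 1), show -(m - 1) - 1 = (-m - 1) + 1 by ring,
        ← levelWeight_succ (by omega), levelWeight_neg_sub_one, mul_assoc, ← mul_add, ← mul_add,
        haar_periodization_add_sphere hE, ← mul_assoc (resCard F ^ (-1 : ℤ)), zpow_neg_one,
        ENNReal.inv_mul_cancel resCard_ne_zero resCard_ne_top, one_mul]
    · refine Set.disjoint_left.mpr ?_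
      rintro ⟨f, n⟩ ⟨-, h1⟩ ⟨-, h2⟩
      simp only [Set.mem_singleton_iff] at h1 h2
      omega
  · have : fareyMap F ⁻¹' (E ×ˢ {0}) = {f : L F | frac (t F * (f : F⸨X⸩)) ∈ E} ×ˢ {-1} := by
      ext ⟨f, n⟩
      simp only [Set.mem_preimage, Set.mem_prod, Set.mem_singleton_iff, Set.mem_ofPred_eq]
      rcases lt_or_ge n 0 with hn | hn
      · rw [fareyMap_apply_of_neg hn, ← eq_neg_iff_add_eq_zero]
      · have h1 : ¬ n = -1 := by omega
        have h2 : ¬ n + 1 = 0 := by omega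
        by_cases hf : (f : F⸨X⸩) ∈ disc 0 2
        · simp [fareyMap_apply_of_mem hf, h1, h2]
        · have h3 : ¬ -(n + 1) = 0 := by omega
          simp only [fareyMap_apply_of_notMem hf hn, h1, h3, and_false]
    rw [this, muG_prod_singleton F _ hS, haar_image_shift hE]
    change levelWeight F (-1) * _ = _
    rw [← levelWeight_neg_sub_one 0]
    simp
  · have : fareyMap F ⁻¹' (E ×ˢ {m}) =
        {f : L F | (f : F⸨X⸩) ∈ disc 0 2 ∧ frac (t F * (f : F⸨X⸩)) ∈ E} ×ˢ {m - 1} := by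
      ext ⟨f, n⟩
      simp only [Set.mem_preimage, Set.mem_prod, Set.mem_singleton_iff, Set.mem_ofPred_eq]
      have h0 : n + 1 = m ↔ n = m - 1 := by omega
      by_cases hf : (f : F⸨X⸩) ∈ disc 0 2
      · simp [fareyMap_apply_of_mem hf, hf, h0]
      · rcases lt_or_ge n 0 with hn | hn
        · have h1 : ¬ n = m - 1 := by omega
          simp only [fareyMap_apply_of_neg hn, hf, h0, h1, and_false]
        · have h3 : ¬ -(n + 1) = m := by omega
          simp only [fareyMap_apply_of_notMem hf hn, hf, h3, and_false, false_and]
    have hM : MeasurableSet {f : L F | (f : F⸨X⸩) ∈ disc 0 2 ∧ frac (t F * (f : F⸨X⸩)) ∈ E} :=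
      hd.inter hS
    rw [this, muG_prod_singleton F _ hM, haar_image_shift_of_mem hE]
    change levelWeight F (m - 1) * _ = _
    rw [← mul_assoc, levelWeight_succ (by omega), sub_add_cancel]

theorem eq_iUnion_level (s : Set (L F × ℤ)) : s = ⋃ n : ℤ, {f | (f, n) ∈ s} ×ˢ {n} := by
  ext ⟨f, n⟩
  simp

theorem measurableSet_level {s : Set (L F × ℤ)} (hs : MeasurableSet s) (n : ℤ) :
    MeasurableSet {f | (f, n) ∈ s} :=
  (measurable_id.prodMk measurable_const) hs

theorem measurePreserving_fareyMap [Fintype F] :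
    MeasurePreserving (fareyMap F) (muG F) (muG F) := by
  refine ⟨measurable_fareyMap, Measure.ext fun s hs => ?_⟩
  have hm : ∀ n : ℤ, MeasurableSet ({f | (f, n) ∈ s} ×ˢ {n} : Set (L F × ℤ)) := fun n =>
    (measurableSet_level hs n).prod (measurableSet_singleton n)
  have hd : Pairwise (Function.onFun Disjoint
      fun n : ℤ => ({f | (f, n) ∈ s} ×ˢ {n} : Set (L F × ℤ))) := fun n m hnm =>
    Set.disjoint_left.mpr fun x hx hx' => hnm (hx.2.symm.trans hx'.2)
  rw [Measure.map_apply measurable_fareyMap hs, eq_iUnion_level s, Set.preimage_iUnion,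
    measure_iUnion (fun n m h => (hd h).preimage _) fun n => measurable_fareyMap (hm n),
    measure_iUnion hd hm]
  exact tsum_congr fun n => muG_preimage_prod_singleton (measurableSet_level hs n) n

end Invariance

/-! ### Orbits and the continued fraction map -/

section Orbits

variable {F : Type*} [Field F]

theorem iterate_fareyMap_neg (n : ℕ) (f : L F) :
    (fareyMap F)^[n] (f, -(n : ℤ)) = (frac (t F ^ (n : ℤ) * (f : F⸨X⸩)), 0) := by
  induction n generalizing f with
  | zero => simp [frac_coe]
  | succ n ih =>
    rw [Function.iterate_succ_apply, fareyMap_apply_of_neg (by omega),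
      show -((n + 1 : ℕ) : ℤ) + 1 = -(n : ℤ) by push_cast; ring, ih,
      frac_t_zpow_mul_frac (by omega), ← mul_assoc, ← zpow_add_one₀ t_ne_zero]
    push_cast
    rfl

theorem t_mul_mem_sphere {f : F⸨X⸩} {d : ℤ} : t F * f ∈ sphere F d ↔ f ∈ sphere F (d + 1) := by
  simp only [sphere_eq_diff, Set.mem_sdiff, t_mul_mem_disc_zero]

theorem exists_iterate_fareyMap_of_mem_sphere (d n : ℕ) {f : L F}
    (hf : (f : F⸨X⸩) ∈ sphere F (d + 1)) :
    ∃ k, (fareyMap F)^[k] (f, (n : ℤ)) = (frac (t F ^ (n : ℤ) * (f : F⸨X⸩)⁻¹), 0) := by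
  induction d generalizing f n with
  | zero =>
    have hf2 : (f : F⸨X⸩) ∉ disc 0 2 := by
      rw [sphere_eq_diff] at hf
      simpa using hf.2
    refine ⟨n + 1 + 1, ?_⟩
    rw [Function.iterate_succ_apply, fareyMap_apply_of_notMem hf2 (by omega)]
    have h := iterate_fareyMap_neg (n + 1) (frac (t F * (f : F⸨X⸩))⁻¹)
    push_cast at h
    rw [h, frac_t_zpow_mul_frac (by omega), mul_inv, ← mul_assoc, zpow_add_one₀ t_ne_zero,
      mul_inv_cancel_right₀ t_ne_zero]
  | succ d ih =>
    have hf2 : (f : F⸨X⸩) ∈ disc 0 2 := by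
      rw [sphere_eq_diff] at hf
      exact disc_subset_disc (by push_cast; omega) hf.1
    have htf : t F * (f : F⸨X⸩) ∈ L F := by
      rw [mem_L_iff_disc, t_mul_mem_disc_zero]
      exact hf2
    have hfrac : (frac (t F * (f : F⸨X⸩)) : F⸨X⸩) = t F * f :=
      congrArg Subtype.val (frac_coe ⟨_, htf⟩)
    obtain ⟨k, hk⟩ := ih (n + 1) (f := frac (t F * (f : F⸨X⸩)))
      (by rw [hfrac, t_mul_mem_sphere]; exact_mod_cast hf)
    refine ⟨k + 1, ?_⟩
    rw [Function.iterate_succ_apply, fareyMap_apply_of_mem hf2]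
    push_cast at hk
    rw [hk, hfrac, mul_inv, ← mul_assoc, zpow_add_one₀ t_ne_zero, mul_inv_cancel_right₀ t_ne_zero]

theorem exists_mem_sphere_of_mem_L {f : F⸨X⸩} (hf : f ∈ L F) (h0 : f ≠ 0) :
    ∃ d : ℕ, f ∈ sphere F (d + 1) := by
  obtain ⟨d, hd⟩ := exists_mem_sphere h0
  have h1 : 1 ≤ d := by
    by_contra! h
    rw [sphere_eq_diff] at hd
    exact hd.2 (disc_subset_disc (by omega) (mem_L_iff_disc.mp hf))
  refine ⟨(d - 1).toNat, ?_⟩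
  rwa [Int.toNat_of_nonneg (by omega), sub_add_cancel]

/-- The first return of the Farey map to level `0` is the continued fraction map
`f ↦ 1 / f - [1 / f]`. -/
theorem exists_iterate_fareyMap_zero {f : L F} (h0 : (f : F⸨X⸩) ≠ 0) :
    ∃ k, (fareyMap F)^[k] (f, 0) = (frac (f : F⸨X⸩)⁻¹, 0) := by
  obtain ⟨d, hd⟩ := exists_mem_sphere_of_mem_L f.2 h0
  simpa using exists_iterate_fareyMap_of_mem_sphere d 0 hd

theorem exists_iterate_fareyMap_level_zero (x : L F × ℤ) (hx : (x.1 : F⸨X⸩) ≠ 0) :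
    ∃ k, ((fareyMap F)^[k] x).2 = 0 := by
  obtain ⟨f, n⟩ := x
  rcases lt_or_ge n 0 with hn | hn
  · obtain ⟨m, rfl⟩ : ∃ m : ℕ, n = -m := ⟨n.natAbs, by omega⟩
    exact ⟨m, by rw [iterate_fareyMap_neg]⟩
  · obtain ⟨m, rfl⟩ := Int.eq_ofNat_of_zero_le hn
    obtain ⟨d, hd⟩ := exists_mem_sphere_of_mem_L f.2 hx
    obtain ⟨k, hk⟩ := exists_iterate_fareyMap_of_mem_sphere d m hd
    exact ⟨k, by rw [hk]⟩

theorem mem_iff_iterate_mem {α : Type*} {T : α → α} {s : Set α} (hs : T ⁻¹' s = s) (k : ℕ)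
    (x : α) : T^[k] x ∈ s ↔ x ∈ s := by
  induction k generalizing x with
  | zero => rfl
  | succ k ih => rw [Function.iterate_succ_apply, ih, ← Set.mem_preimage, hs]

end Orbits

/-! ### The zero-one law -/

section ZeroOne

variable {F : Type*} [Field F] [Fintype F]

/-- A disc that avoids `0` is mapped by inversion to a disc of larger radius, where the density of
an invariant set is already known. -/
theorem haar_periodization_inter_disc_of_mem_sphere {E : Set (L F)} (hE : MeasurableSet E)
    (hinv : ∀ f : L F, (f : F⸨X⸩) ≠ 0 → (frac (f : F⸨X⸩)⁻¹ ∈ E ↔ f ∈ E)) {m d : ℤ}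
    (ih : ∀ k < m, ∀ g, haar F (periodization E ∩ disc g k) =
      resCard F ^ (1 - k) * haar F (periodization E ∩ disc 0 1))
    {g : F⸨X⸩} (hg : g ∈ sphere F d) (hd : 1 ≤ d) (hdm : d < m) :
    haar F (periodization E ∩ disc g m) =
      resCard F ^ (1 - m) * haar F (periodization E ∩ disc 0 1) := by
  have hgm : disc g m ⊆ sphere F d := disc_subset_sphere hg hdm
  have hset : periodization E ∩ disc g m =
      {f | f⁻¹ ∈ periodization E ∩ disc g⁻¹ (m - 2 * d)} ∩ sphere F d := by
    have hper : ∀ f ∈ sphere F d, f⁻¹ ∈ periodization E ↔ f ∈ periodization E := by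
      intro f hf
      have hfL : f ∈ L F := by
        rw [sphere_eq_diff] at hf
        exact mem_L_iff_disc.mpr (disc_subset_disc hd hf.1)
      rw [mem_periodization, hinv ⟨f, hfL⟩ (ne_zero_of_mem_sphere hf)]
      exact coe_mem_periodization.symm
    have hdisc : ∀ f ∈ sphere F d, f⁻¹ ∈ disc g⁻¹ (m - 2 * d) ↔ f ∈ disc g m := fun f hf => by
      rw [inv_mem_disc_inv hf hg, sub_add_cancel]
    ext f
    constructor
    · rintro ⟨h1, h2⟩
      exact ⟨⟨(hper f (hgm h2)).mpr h1, (hdisc f (hgm h2)).mpr h2⟩, hgm h2⟩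
    · rintro ⟨⟨h1, h2⟩, h3⟩
      exact ⟨(hper f h3).mp h1, (hdisc f h3).mp h2⟩
  rw [hset, haar_preimage_inv d ((measurableSet_periodization hE).inter (measurableSet_disc _ _)),
    Set.inter_assoc, Set.inter_eq_left.mpr
      (disc_subset_sphere (inv_mem_sphere.mpr hg) (by omega : -d < m - 2 * d)),
    ih _ (by omega), ← mul_assoc, resCard_zpow_mul_zpow]
  congr 2
  ring

/-- A set invariant under the continued fraction map has the same density in every disc. The disc
centred at `0` is handled as the complement of the other discs of the same radius in a larger
disc. -/
theorem haar_periodization_inter_disc {E : Set (L F)} (hE : MeasurableSet E)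
    (hinv : ∀ f : L F, (f : F⸨X⸩) ≠ 0 → (frac (f : F⸨X⸩)⁻¹ ∈ E ↔ f ∈ E)) (g : F⸨X⸩) (m : ℤ) :
    haar F (periodization E ∩ disc g m) =
      resCard F ^ (1 - m) * haar F (periodization E ∩ disc 0 1) := by
  classical
  suffices H : ∀ N : ℕ, ∀ m : ℤ, m ≤ N + 1 → ∀ g, haar F (periodization E ∩ disc g m) =
      resCard F ^ (1 - m) * haar F (periodization E ∩ disc 0 1) from
    H m.toNat m (by omega) g
  intro N
  induction N with
  | zero => exact fun m hm g => haar_periodization_inter_disc_of_le hE g (by simpa using hm)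
  | succ N ih =>
    intro m hm g
    rcases hm.lt_or_eq with hlt | hm
    · exact ih m (by push_cast at hlt; omega) g
    push_cast at hm
    have ih' : ∀ k < m, ∀ g, haar F (periodization E ∩ disc g k) =
        resCard F ^ (1 - k) * haar F (periodization E ∩ disc 0 1) := fun k hk =>
      ih k (by omega)
    set b := resCard F ^ (1 - m) * haar F (periodization E ∩ disc 0 1) with hb
    have hb_top : b ≠ ∞ := ENNReal.mul_ne_top (zpow_ne_zero_ne_top _).2
      (ne_top_of_le_ne_top (haar_disc_ne_top 0 1) (measure_mono Set.inter_subset_right))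
    have hzero : haar F (periodization E ∩ disc 0 m) = b := by
      have hsum := measure_inter_disc (haar F) (measurableSet_periodization hE) (0 : F⸨X⸩) (m - 1)
      simp only [zero_add, sub_add_cancel] at hsum
      have hne : ∀ a ∈ Finset.univ.erase (0 : F),
          haar F (periodization E ∩ disc (HahnSeries.single (m - 1) a) m) = b := by
        intro a ha
        refine haar_periodization_inter_disc_of_mem_sphere hE hinv ih' (d := m - 1) ?_
          (by omega) (by omega)
        rw [sphere_eq_diff, Set.mem_sdiff, mem_disc_iff_coeff, mem_disc_iff_coeff]
        refine ⟨fun i hi => HahnSeries.coeff_single_of_ne hi.ne, fun h => ?_⟩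
        exact (Finset.mem_erase.mp ha).1 (by simpa using h (m - 1) (by omega))
      have htot : haar F (periodization E ∩ disc 0 (m - 1)) = ∑ _a : F, b := by
        rw [ih' _ (by omega), Finset.sum_const, Finset.card_univ, nsmul_eq_mul, hb, ← mul_assoc,
          resCard_mul_zpow]
        congr 2
        ring
      rw [htot, ← Finset.add_sum_erase _ _ (Finset.mem_univ (0 : F)),
        ← Finset.add_sum_erase _ _ (Finset.mem_univ (0 : F)), Finset.sum_congr rfl hne,
        ENNReal.add_left_inj (ENNReal.sum_ne_top.mpr fun _ _ => hb_top)] at hsum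
      simpa using hsum.symm
    rw [← haar_periodization_inter_disc_frac]
    by_cases hg : (frac g : F⸨X⸩) ∈ disc 0 m
    · rw [disc_eq_of_mem hg, hzero]
    · have h0 : (frac g : F⸨X⸩) ≠ 0 := fun h => hg (by rw [h]; exact self_mem_disc 0 m)
      obtain ⟨d, hd⟩ := exists_mem_sphere_of_mem_L (frac g).2 h0
      refine haar_periodization_inter_disc_of_mem_sphere hE hinv ih' hd (by omega) ?_
      by_contra! h
      rw [sphere_eq_diff] at hd
      exact hg (disc_subset_disc h hd.1)

theorem haar_periodization_eq_zero_or {E : Set (L F)} (hE : MeasurableSet E)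
    (hinv : ∀ f : L F, (f : F⸨X⸩) ≠ 0 → (frac (f : F⸨X⸩)⁻¹ ∈ E ↔ f ∈ E)) :
    haar F (periodization E) = 0 ∨ haar F (periodization E)ᶜ = 0 := by
  have hP := measurableSet_periodization hE
  set c := resCard F * haar F (periodization E ∩ disc 0 1) with hc
  have key : (haar F).restrict (periodization E) = c • haar F := by
    refine ext_of_discs 0 (fun g => ?_) fun g m _ => ?_
    · exact ne_top_of_le_ne_top (haar_disc_ne_top g 0) (Measure.restrict_apply_le _ _)
    · rw [Measure.restrict_apply (measurableSet_disc _ _), Set.inter_comm,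
        haar_periodization_inter_disc hE hinv, Measure.smul_apply, smul_eq_mul, haar_disc, hc,
        mul_right_comm, resCard_mul_zpow, neg_add_eq_sub]
  have h := congrArg (fun μ => μ (periodization E)ᶜ) key
  simp only [Measure.restrict_apply hP.compl, Set.compl_inter_self, measure_empty,
    Measure.smul_apply, smul_eq_mul] at h
  rcases mul_eq_zero.mp h.symm with h0 | h0
  · left
    rw [h0, zero_smul] at key
    exact Measure.restrict_eq_zero.mp key
  · exact Or.inr h0

theorem haar_singleton_zero : haar F {0} = 0 := by
  by_contra h0
  have htop : haar F {0} ≠ ∞ := ne_top_of_le_ne_top (haar_disc_ne_top 0 0)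
    (measure_mono (Set.singleton_subset_iff.mpr (self_mem_disc 0 0)))
  have hm : MeasurableSet ({0} : Set F⸨X⸩) := measurableSet_singleton 0
  have h := haar_preimage_t_mul hm
  have hset : {f : F⸨X⸩ | t F * f ∈ ({0} : Set F⸨X⸩)} = {0} := by
    ext f
    simp [t_ne_zero]
  rw [hset] at h
  have h1 : resCard F ^ (-1 : ℤ) = 1 := by
    refine (ENNReal.mul_left_inj h0 htop).mp ?_
    rw [one_mul, ← h]
  rw [zpow_neg_one, ENNReal.inv_eq_one] at h1
  exact Fintype.one_lt_card.ne' (by exact_mod_cast h1 : Fintype.card F = 1)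

/-- Almost every orbit visits level `0`, so an invariant set is null as soon as its part of
level `0` is. -/
theorem muG_eq_zero_of_level_zero {s : Set (L F × ℤ)} (hs : MeasurableSet s)
    (hinv : fareyMap F ⁻¹' s = s)
    (h0 : haar F (periodization {f | (f, (0 : ℤ)) ∈ s}) = 0) : muG F s = 0 := by
  set E : Set (L F) := {f | (f, (0 : ℤ)) ∈ s} with hEdef
  have hE : MeasurableSet E := measurableSet_level hs 0
  set Z : Set (L F) := {f | (f : F⸨X⸩) = 0} with hZdef
  have hZ : MeasurableSet Z := measurable_subtype_coe (measurableSet_singleton (0 : F⸨X⸩))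
  have hsub : s ⊆ (⋃ n : ℤ, Z ×ˢ {n}) ∪ ⋃ k : ℕ, (fareyMap F)^[k] ⁻¹' (E ×ˢ {0}) := by
    intro x hx
    by_cases hx0 : (x.1 : F⸨X⸩) = 0
    · exact Or.inl (Set.mem_iUnion.mpr ⟨x.2, hx0, rfl⟩)
    · obtain ⟨k, hk⟩ := exists_iterate_fareyMap_level_zero x hx0
      refine Or.inr (Set.mem_iUnion.mpr ⟨k, ?_, hk⟩)
      have := (mem_iff_iterate_mem hinv k x).mpr hx
      rwa [← Prod.mk.eta (p := (fareyMap F)^[k] x), hk] at this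
  refine measure_mono_null hsub (measure_union_null ?_ ?_)
  · refine measure_iUnion_null fun n => ?_
    rw [muG_prod_singleton F _ hZ, mul_eq_zero]
    refine Or.inr (measure_mono_null ?_ haar_singleton_zero)
    rintro _ ⟨f, hf, rfl⟩
    exact hf
  · refine measure_iUnion_null fun k => ?_
    rw [(measurePreserving_fareyMap.iterate k).measure_preimage
      (hE.prod (measurableSet_singleton 0)).nullMeasurableSet, muG_prod_singleton' hE,
      measure_mono_null Set.inter_subset_left h0, mul_zero]

end ZeroOne
end GeometricFarey

end

theorem theorem1 (F : Type*) [Field F] [Fintype F] :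
    Ergodic (GeometricFarey.fareyMap F) (GeometricFarey.muG F) := by
  open GeometricFarey in
  refine ⟨measurePreserving_fareyMap, ⟨fun s hs hinv => ?_⟩⟩
  have h01 := haar_periodization_eq_zero_or (measurableSet_level hs 0) fun f hf => by
    obtain ⟨k, hk⟩ := exists_iterate_fareyMap_zero hf
    change (_, _) ∈ s ↔ (_, _) ∈ s
    rw [← hk, mem_iff_iterate_mem hinv]
  rw [Filter.eventuallyConst_set', ae_eq_empty, ae_eq_univ]
  refine h01.imp (muG_eq_zero_of_level_zero hs hinv) fun h => ?_
  exact muG_eq_zero_of_level_zero hs.compl (by rw [Set.preimage_compl, hinv]) h
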